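/- Let $d\ge 1$, let $\mathcal A$ be a finite discrete alphabet, and let $X\subseteq\mathcal A^{\mathbb Z^d}$ be a subshift, i.e. a closed set with $\sigma^j(X)\subseteq X$ for all $j\in\mathbb Z^d$, where $\sigma^j(x)=(x_{i+j})_{i\in\mathbb Z^d}$. Put $\Lambda_n=\{i\in\mathbb Z^d:\max_l|i_l|<n\}$. Let $f\in SV_d(X)$, i.e. $f:X\to\mathbb R$ with $\sum_{n\ge1}n^{d-1}\delta_n(f)<\infty$, where $\delta_n(f)=\sup\{|f(x)-f(y)|:x,y\in X,\ x_{\Lambda_n}=y_{\Lambda_n}\}\in[0,\infty]$. Write $f_n=\sum_{i\in\Lambda_n}f\circ\sigma^i$. For a nonempty finite set $\Lambda\subseteq\mathbb Z^d$, a Borel set $A\subseteq X$ and $x\in X$, let $$\gamma_\Lambda(A\mid x)=\lim_{n\to\infty}\frac{\sum_{\omega\in\mathcal A^\Lambda}e^{f_n(\omega x_{\Lambda^c})}\mathbf 1_{\{\omega x_{\Lambda^c}\in A\}}}{\sum_{\eta\in\mathcal A^\Lambda}e^{f_n(\eta x_{\Lambda^c})}\mathbf 1_{\{\eta x_{\Lambda^c}\in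 X\}}}$$ (the limit exists), where $\omega x_{\Lambda^c}$ is the configuration equal to $\omega$ on $\Lambda$ and to $x$ on $\Lambda^c$. Let $\mathcal B_{\Lambda^c}$ be the $\sigma$-algebra on $X$ generated by the coordinates in $\Lambda^c$. Let $\mathcal F(X)$ be the set of homeomorphisms $\varphi$ of $X$ for which there is $n$ with $\varphi(x)_{\Lambda_n^c}=x_{\Lambda_n^c}$ for all $x\in X$, let $\mathfrak T^0=\{(x,\varphi(x)):x\in X,\ \varphi\in\mathcal F(X)\}$, and let $c_f(x,y)=\sum_{k\in\mathbb Z^d}\bigl(f(\sigma^ky)-f(\sigma^kx)\bigr)$ (unordered sum) for $(x,y)\in\mathfrak T^0$. For a Borel probability measure $\mu$ on $X$, let $\nu_r(C)=\int_X|\{y:(x,y)\in C\}|\,d\mu(x)$ for Borel $C\subseteq\mathfrak T^0$, and let $\nu_s$ be the image of $\nu_r$ under $(x,y)\mapsto(y,x)$. The measure $\mu$ is a \emph{topological Gibbs measure} for $f$ if it is quasi-invariant under $\mathfrak T^0$ (the $\mathfrak T^0$-saturation of every $\mu$-null Borel set is $\mu$-null) and $\frac{d\nu_r}{d\nu_s}=e^{-c_f}$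 almost everywhere on $\mathfrak T^0$. \textbf{Theorem.} Let $\mu$ be a Borel probability measure on $X$ that satisfies the DLR equations $$\mu(A\mid\mathcal B_{\Lambda^c})=\gamma_\Lambda(A\mid\cdot\,)\quad\mu\text{-a.e.}$$ for every nonempty finite $\Lambda\subseteq\mathbb Z^d$ and every Borel set $A\subseteq X$. Then $\mu$ is a topological Gibbs measure for $f$. Moreover, for every $\varphi\in\mathcal F(X)$ the measure $\varphi_*\mu$ is absolutely continuous with respect to $\mu$ and $$\frac{d\varphi_*\mu}{d\mu}(x)=e^{c_f(x,\varphi^{-1}(x))}\quad\text{for }\mu\text{-almost every }x\in X.$$ -/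

import Mathlib

open MeasureTheory ProbabilityTheory Filter Topology
open scoped ENNReal

namespace GibbsSubshift

noncomputable section

/-! ### Countable Borel equivalence relations and conformal measures -/

section Conformal

variable {α : Type*} [MeasurableSpace α]

/-- The relation `R`, seen as a subset of `α × α`, with the trace of the product `σ`-algebra. -/
abbrev Graph (R : α → α → Prop) : Type _ := {p : α × α // R p.1 p.2}

/-- The left counting measure of `μ` on `R`: it sends a measurable set `C` to
`∫ |r⁻¹{x} ∩ C| dμ(x)`, where `r (x, y) = x`. -/
def leftCountingMeasure (μ : Measure α) (R : α → α → Prop) : Measure (Graph R) :=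
  μ.bind fun x => Measure.count.restrict {p : Graph R | p.1.1 = x}

/-- The right counting measure of `μ` on `R`: the push-forward of the left counting measure under
the flip `(x, y) ↦ (y, x)`. -/
def rightCountingMeasure (μ : Measure α) (R : α → α → Prop) [Std.Symm R] : Measure (Graph R) :=
  (leftCountingMeasure μ R).map fun p => ⟨(p.1.2, p.1.1), Std.Symm.symm _ _ p.2⟩

/-- The saturation `R(A)` of a set `A`. -/
def saturation (R : α → α → Prop) (A : Set α) : Set α := {y | ∃ x ∈ A, R x y}

/-- `μ` is quasi-invariant under `R`: the saturation of a null Borel set is null. -/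
def IsQuasiInvariant (μ : Measure α) (R : α → α → Prop) : Prop :=
  ∀ A : Set α, MeasurableSet A → μ A = 0 → μ (saturation R A) = 0

/-- The Radon–Nikodym derivative `D_{μ,R} = dν_r/dν_s` of `μ` with respect to `R`. -/
def radonNikodym (μ : Measure α) (R : α → α → Prop) [Std.Symm R] : Graph R → ℝ≥0∞ :=
  (leftCountingMeasure μ R).rnDeriv (rightCountingMeasure μ R)

/-- `μ` is `(c, R)`-conformal: `μ` is quasi-invariant under `R` and `D_{μ,R} = e^{-c}` almost
everywhere. -/
def IsConformal (μ : Measure α) (R : α → α → Prop) [Std.Symm R] (c : Graph R → ℝ) : Prop :=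
  IsQuasiInvariant μ R ∧
    radonNikodym μ R =ᵐ[rightCountingMeasure μ R] fun p => ENNReal.ofReal (Real.exp (-(c p)))

/-- For a relation that is a countable union of graphs of measurable maps, the fibre counting
measures depend measurably on the base point. -/
theorem measurable_fibreCount [MeasurableEq α] {R : α → α → Prop} (g : ℕ → α → α)
    (hg : ∀ n, Measurable (g n)) (hR : ∀ x y, R x y ↔ ∃ n, y = g n x) :
    Measurable fun x => Measure.count.restrict {p : Graph R | p.1.1 = x} := by
  refine Measure.measurable_of_measurable_coe _ fun C hC => ?_
  -- the part of `C` where `n` is the first index with `y = g n x`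
  let P : ℕ → Set (Graph R) := fun n =>
    {p | p.1.2 = g n p.1.1} ∩ ⋂ m ∈ Set.Iio n, {p | p.1.2 = g m p.1.1}ᶜ
  have hm1 : Measurable fun p : Graph R => p.1.1 := measurable_fst.comp measurable_subtype_coe
  have hm2 : Measurable fun p : Graph R => p.1.2 := measurable_snd.comp measurable_subtype_coe
  have hE : ∀ n, MeasurableSet {p : Graph R | p.1.2 = g n p.1.1} := fun n =>
    measurableSet_eq_fun hm2 ((hg n).comp hm1)
  have hP : ∀ n, MeasurableSet (P n) := fun n =>
    (hE n).inter (MeasurableSet.biInter (Set.to_countable _) fun m _ => (hE m).compl)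
  have hF : ∀ x, MeasurableSet {p : Graph R | p.1.1 = x} := fun x =>
    measurableSet_eq_fun hm1 measurable_const
  have hdisj : Pairwise (Function.onFun Disjoint P) := by
    intro n m hnm
    rw [Function.onFun, Set.disjoint_left]
    rintro p ⟨hp1, hp2⟩ ⟨hp3, hp4⟩
    simp only [Set.mem_iInter] at hp2 hp4
    rcases lt_or_gt_of_ne hnm with h | h
    · exact hp4 n h hp1
    · exact hp2 m h hp3
  have hcover : ⋃ n, P n = Set.univ := by
    classical
    refine Set.eq_univ_of_forall fun p => Set.mem_iUnion.2 ?_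
    have hex := (hR _ _).1 p.2
    refine ⟨Nat.find hex, Nat.find_spec hex, ?_⟩
    simp only [Set.mem_iInter]
    exact fun m hm => Nat.find_min hex hm
  let s : ℕ → α → Graph R := fun n x => ⟨(x, g n x), (hR _ _).2 ⟨n, rfl⟩⟩
  have hs : ∀ n, Measurable (s n) := fun n => (measurable_id.prodMk (hg n)).subtype_mk
  have hkey : ∀ x, Measure.count.restrict {p : Graph R | p.1.1 = x} C =
      ∑' n, (s n ⁻¹' (C ∩ P n)).indicator (fun _ => (1 : ℝ≥0∞)) x := by
    intro x
    rw [Measure.restrict_apply hC]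
    have h1 : C ∩ {p : Graph R | p.1.1 = x} =
        ⋃ n, (C ∩ {p : Graph R | p.1.1 = x}) ∩ P n := by
      rw [← Set.inter_iUnion, hcover, Set.inter_univ]
    rw [h1, measure_iUnion
      (fun n m hnm => (hdisj hnm).mono Set.inter_subset_right Set.inter_subset_right)
      (fun n => (hC.inter (hF x)).inter (hP n))]
    refine tsum_congr fun n => ?_
    have hsub : (C ∩ {p : Graph R | p.1.1 = x}) ∩ P n ⊆ {s n x} := by
      rintro p ⟨⟨_, hpx⟩, hp, _⟩
      refine Subtype.ext (Prod.ext hpx ?_)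
      have hpx' : p.1.1 = x := hpx
      have hp' : p.1.2 = g n p.1.1 := hp
      rw [hp', hpx']
    by_cases h : x ∈ s n ⁻¹' (C ∩ P n)
    · have : (C ∩ {p : Graph R | p.1.1 = x}) ∩ P n = {s n x} :=
        hsub.antisymm (Set.singleton_subset_iff.2 ⟨⟨h.1, rfl⟩, h.2⟩)
      rw [Set.indicator_of_mem h, this, Measure.count_singleton]
    · have : (C ∩ {p : Graph R | p.1.1 = x}) ∩ P n = ∅ := by
        refine Set.eq_empty_of_forall_notMem fun p hp => h ?_
        have : p = s n x := hsub hp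
        rw [Set.mem_preimage, ← this]
        exact ⟨hp.1.1, hp.2⟩
      rw [Set.indicator_of_notMem h, this, measure_empty]
  simp_rw [hkey]
  exact Measurable.tsum fun n =>
    measurable_const.indicator ((hs n) (hC.inter (hP n)))

end Conformal

/-! ### Subshifts over a finite alphabet -/

/-- Configurations on the lattice `ℤ^d`, with the product topology and product `σ`-algebra. -/
abbrev Config (d : ℕ) (𝒜 : Type*) : Type _ := (Fin d → ℤ) → 𝒜

/-- The shift by `j`: `(σ^j x)_i = x_{i+j}`. -/
def shift {d : ℕ} {𝒜 : Type*} (j : Fin d → ℤ) (x : Config d 𝒜) : Config d 𝒜 :=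
  fun i => x (i + j)

/-- The box `Λ_n = {i : ‖i‖ < n}` for the sup norm. -/
def box (d n : ℕ) : Finset (Fin d → ℤ) :=
  Fintype.piFinset fun _ => Finset.Ioo (-(n : ℤ)) n

theorem mem_box {d n : ℕ} {i : Fin d → ℤ} : i ∈ box d n ↔ ∀ l, |i l| < (n : ℤ) := by
  simp [box, abs_lt]

/-- The configuration `ω x_{Λᶜ}`: equal to `ω` on `Λ` and to `x` off `Λ`. -/
def glue {d : ℕ} {𝒜 : Type*} (Λ : Finset (Fin d → ℤ)) (ω : Λ → 𝒜) (x : Config d 𝒜) :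
    Config d 𝒜 :=
  fun i => if h : i ∈ Λ then ω ⟨i, h⟩ else x i

/-- A subshift: a closed, translation invariant set of configurations. -/
structure Subshift (d : ℕ) (𝒜 : Type*) [TopologicalSpace 𝒜] where
  carrier : Set (Config d 𝒜)
  isClosed : IsClosed carrier
  shift_mem : ∀ (j : Fin d → ℤ), ∀ x ∈ carrier, shift j x ∈ carrier

section Subshift

variable {d : ℕ} {𝒜 : Type*} [TopologicalSpace 𝒜]

/-- The points of a subshift; they form a subspace of the space of all configurations. -/
abbrev Subshift.Pt (X : Subshift d 𝒜) : Type _ := X.carrier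

variable {X : Subshift d 𝒜}

/-- The shift as a self-map of a subshift. -/
def Subshift.shift (X : Subshift d 𝒜) (j : Fin d → ℤ) (x : X.Pt) : X.Pt :=
  ⟨GibbsSubshift.shift j x.1, X.shift_mem j x.1 x.2⟩

/-- The `n`-th variation
`δ_n(f) = sup {|f x - f y| : x, y ∈ X agree on Λ_n}`, with values in `[0, ∞]`. -/
def variation (f : X.Pt → ℝ) (n : ℕ) : ℝ≥0∞ :=
  ⨆ (x : X.Pt) (y : X.Pt) (_ : ∀ i ∈ box d n, x.1 i = y.1 i), ENNReal.ofReal |f x - f y|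

/-- The set `SV_d(X)` of functions with `d`-summable variation:
`∑_{n ≥ 1} n^{d-1} δ_n(f) < ∞`. -/
def SV (X : Subshift d 𝒜) : Set (X.Pt → ℝ) :=
  {f | ∑' n : ℕ, ((n + 1 : ℕ) : ℝ≥0∞) ^ (d - 1) * variation f (n + 1) < ∞}

/-- The cocycle `c_f(x, y) = ∑_{k ∈ ℤ^d} (f(σ^k y) - f(σ^k x))`, an unordered sum. -/
def cocycle (f : X.Pt → ℝ) (x y : X.Pt) : ℝ :=
  ∑' k : Fin d → ℤ, (f (X.shift k y) - f (X.shift k x))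

/-- `𝓕(X)`: the homeomorphisms of `X` that do not change configurations outside some box. -/
def localHomeos (X : Subshift d 𝒜) : Set (X.Pt ≃ₜ X.Pt) :=
  {φ | ∃ n : ℕ, ∀ x : X.Pt, ∀ i, i ∉ box d n → (φ x).1 i = x.1 i}

/-- The topological Gibbs relation `𝔗⁰`. -/
def topGibbsRel (X : Subshift d 𝒜) (x y : X.Pt) : Prop :=
  ∃ φ ∈ localHomeos X, y = φ x

instance (X : Subshift d 𝒜) : Std.Symm (topGibbsRel X) where
  symm := by
    rintro x y ⟨φ, ⟨n, hn⟩, rfl⟩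
    refine ⟨φ.symm, ⟨n, fun z i hi => ?_⟩, by simp⟩
    have h := hn (φ.symm z) i hi
    rw [Homeomorph.apply_symm_apply] at h
    exact h.symm

/-- `f_n = ∑_{i ∈ Λ_n} f ∘ σ^i`. -/
def boxSum (f : X.Pt → ℝ) (n : ℕ) (x : X.Pt) : ℝ :=
  ∑ i ∈ box d n, f (X.shift i x)

open Classical in
/-- `e^{f_n(ω x_{Λᶜ})}` if `ω x_{Λᶜ}` is a point of `A ⊆ X`, and `0` otherwise. -/
def weight (f : X.Pt → ℝ) (n : ℕ) (Λ : Finset (Fin d → ℤ)) (A : Set X.Pt) (x : X.Pt)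
    (ω : Λ → 𝒜) : ℝ :=
  if h : ∃ hX : glue Λ ω x.1 ∈ X.carrier, (⟨glue Λ ω x.1, hX⟩ : X.Pt) ∈ A then
    Real.exp (boxSum f n ⟨glue Λ ω x.1, h.1⟩)
  else 0

/-- The specification associated with `f`:
`γ_Λ(A | x) = lim_n (∑_ω e^{f_n(ω x_{Λᶜ})} 1_{ω x_{Λᶜ} ∈ A}) / (∑_η e^{f_n(η x_{Λᶜ})} 1_{η x_{Λᶜ} ∈ X})`.
The limit exists for every `f` in `SV X`. -/
def specification [Fintype 𝒜] (f : X.Pt → ℝ) (Λ : Finset (Fin d → ℤ)) (A : Set X.Pt)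
    (x : X.Pt) : ℝ :=
  limUnder atTop fun n : ℕ =>
    (∑ ω : Λ → 𝒜, weight f n Λ A x ω) / (∑ η : Λ → 𝒜, weight f n Λ Set.univ x η)

/-- The `σ`-algebra `𝓑_Δ` on `X` generated by the coordinates in `Δ`. -/
@[reducible] def coordSigma (X : Subshift d 𝒜) (Δ : Set (Fin d → ℤ)) : MeasurableSpace X.Pt :=
  MeasurableSpace.generateFrom {S | ∃ i ∈ Δ, ∃ B : Set 𝒜, S = {x : X.Pt | x.1 i ∈ B}}

/-! The left counting measure of the topological Gibbs relation is given by the expected formula. -/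

instance [Fintype 𝒜] (X : Subshift d 𝒜) : CompactSpace X.Pt :=
  isCompact_iff_compactSpace.1 X.isClosed.isCompact

theorem countable_localHomeos [Fintype 𝒜] [DiscreteTopology 𝒜] (X : Subshift d 𝒜) :
    (localHomeos X).Countable := by
  have : Countable (TopologicalSpace.Clopens X.Pt) := by
    rw [TopologicalSpace.Clopens.countable_iff_secondCountable]; infer_instance
  let F : X.Pt ≃ₜ X.Pt → ℕ → Prop := fun φ n =>
    ∀ x : X.Pt, ∀ i, i ∉ box d n → (φ x).1 i = x.1 i
  have hF : localHomeos X = ⋃ n, {φ | F φ n} := by ext; simp [localHomeos, F]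
  rw [hF]
  refine Set.countable_iUnion fun n => ?_
  let G : (X.Pt ≃ₜ X.Pt) → (box d n × 𝒜 → TopologicalSpace.Clopens X.Pt) := fun φ p =>
    ⟨{x | (φ x).1 p.1.1 = p.2}, (isClopen_discrete {p.2}).preimage
      ((continuous_apply p.1.1).comp (continuous_subtype_val.comp φ.continuous))⟩
  refine Set.MapsTo.countable_of_injOn (f := G) (t := Set.univ) (fun _ _ => trivial) ?_
    Set.countable_univ
  intro φ hφ ψ hψ h
  ext x i
  by_cases hi : i ∈ box d n
  · have h1 := congrFun h (⟨i, hi⟩, (φ x).1 i)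
    have h2 : x ∈ (G ψ (⟨i, hi⟩, (φ x).1 i) : Set X.Pt) := by rw [← h1]; exact rfl
    exact Eq.symm h2
  · rw [hφ x i hi, hψ x i hi]

theorem leftCountingMeasure_topGibbsRel_apply [Fintype 𝒜] [DiscreteTopology 𝒜] [MeasurableSpace 𝒜]
    [BorelSpace 𝒜] (X : Subshift d 𝒜) (μ : Measure X.Pt) {C : Set (Graph (topGibbsRel X))}
    (hC : MeasurableSet C) :
    leftCountingMeasure μ (topGibbsRel X) C =
      ∫⁻ x, (({p : Graph (topGibbsRel X) | p.1.1 = x} ∩ C).encard : ℝ≥0∞) ∂μ := by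
  have hm : Measurable fun x =>
      Measure.count.restrict {p : Graph (topGibbsRel X) | p.1.1 = x} := by
    obtain ⟨g, hg⟩ :=
      (countable_localHomeos X).exists_eq_range ⟨Homeomorph.refl _, 0, fun _ _ _ => rfl⟩
    refine measurable_fibreCount (fun n => g n) (fun n => (g n).measurable) fun x y => ?_
    simp [topGibbsRel, hg]
  rw [leftCountingMeasure, Measure.bind_apply hC hm.aemeasurable]
  congr with x
  rw [Measure.restrict_apply hC, Set.inter_comm, Measure.count_apply]
  exact (measurableSet_eq_fun (measurable_fst.comp measurable_subtype_coe)
    measurable_const).inter hC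

variable [MeasurableSpace 𝒜]

theorem coordSigma_le [DiscreteTopology 𝒜] [BorelSpace 𝒜] (X : Subshift d 𝒜)
    (Δ : Set (Fin d → ℤ)) : coordSigma X Δ ≤ (inferInstance : MeasurableSpace X.Pt) := by
  refine MeasurableSpace.generateFrom_le ?_
  rintro S ⟨i, -, B, rfl⟩
  exact ((measurable_pi_apply i).comp measurable_subtype_coe) (isOpen_discrete B).measurableSet

/-- The DLR equations: `μ(A | 𝓑_{Λᶜ}) = γ_Λ(A | ·)` `μ`-almost everywhere, for every nonempty finite
`Λ ⊆ ℤ^d` and every Borel set `A ⊆ X`. -/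
def SatisfiesDLR [Fintype 𝒜] (f : X.Pt → ℝ) (μ : Measure X.Pt) : Prop :=
  ∀ Λ : Finset (Fin d → ℤ), Λ.Nonempty → ∀ A : Set X.Pt, MeasurableSet A →
    μ⟦A | coordSigma X (Λ : Set (Fin d → ℤ))ᶜ⟧ =ᵐ[μ] specification f Λ A

/-- `μ` is a topological Gibbs measure for `f`: it is `(c_f, 𝔗⁰)`-conformal. -/
def IsTopologicalGibbs (f : X.Pt → ℝ) (μ : Measure X.Pt) : Prop :=
  IsConformal μ (topGibbsRel X) fun p => cocycle f p.1.1 p.1.2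

end Subshift

end

end GibbsSubshift

namespace GibbsSubshift

noncomputable section

/-! ### Functions with summable variation -/

section Variation

variable {d : ℕ} {𝒜 : Type*} [TopologicalSpace 𝒜] {X : Subshift d 𝒜} {f : X.Pt → ℝ}

/-! Dividing numerator and denominator of the specification by `e^{f_m(x)}` leaves the exponents
`f_m(y) - f_m(x)`, which converge to `c_f(x, y)` because shells of radius `n` have `O(n^{d-1})`
points and `f` has `d`-summable variation. So `γ_{Λ_n}(· | x)` is a probability on the finitely many
`y ∈ X` agreeing with `x` off `Λ_n`, with weights proportional to `e^{c_f(x, y)}`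
(`specification_box`).

A local homeomorphism `φ` supported in `Λ_n` permutes these `y`, and by the cocycle identity
reindexing by `φ` costs the factor `e^{c_f(z, φ⁻¹ z)}` (`specAverage_comp`). Integrating against
`μ`, the DLR equations remove the averages (`lintegral_specAverage`), which gives the density of
`φ_*μ` (`map_eq_withDensity`).

The relation is a countable union of graphs of such `φ`. On one graph, `ν_r` is a copy of `μ` and
`ν_s` a copy of `(φ⁻¹)_*μ`, so the density formula for `φ⁻¹` reads `ν_r = e^{-c_f} ν_s` there. -/

theorem box_mono (d : ℕ) : Monotone (box d) := fun m n h i hi => by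
  rw [mem_box] at hi ⊢
  exact fun l => (hi l).trans_le (by exact_mod_cast h)

theorem exists_mem_box (i : Fin d → ℤ) : ∃ n, i ∈ box d n := by
  refine ⟨(Finset.univ.sup fun l => (i l).natAbs) + 1, mem_box.2 fun l => ?_⟩
  have : (i l).natAbs ≤ Finset.univ.sup fun l => (i l).natAbs :=
    Finset.le_sup (f := fun l => (i l).natAbs) (Finset.mem_univ l)
  rw [Int.abs_eq_natAbs]
  exact_mod_cast Nat.lt_succ_of_le this

theorem tendsto_box_atTop (d : ℕ) : Tendsto (box d) atTop atTop :=
  tendsto_atTop_finset_of_monotone (box_mono d) exists_mem_box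

theorem card_box (d n : ℕ) : (box d n).card = (2 * n - 1) ^ d := by
  have : ((n : ℤ) + n).toNat - 1 = 2 * n - 1 := by omega
  simp [box, this]

/-- A discrete mean value bound. Assuming `a ≤ b + 2` instead of equality allows the truncated side
length `2 * 0 - 1 = 0` of the empty box. -/
theorem pow_le_pow_add_of_le_add_two {a b : ℕ} (h : a ≤ b + 2) (hba : b ≤ a) (d : ℕ) :
    a ^ d ≤ b ^ d + 2 * d * a ^ (d - 1) := by
  induction d with
  | zero => simp
  | succ d ih =>
    rcases d with _ | d
    · simpa using h
    · simp only [Nat.add_sub_cancel] at ih ⊢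
      calc a ^ (d + 1 + 1) = a * a ^ (d + 1) := by ring
        _ ≤ (b + 2) * a ^ (d + 1) := by gcongr
        _ = b * a ^ (d + 1) + 2 * a ^ (d + 1) := by ring
        _ ≤ b * (b ^ (d + 1) + 2 * (d + 1) * a ^ d) + 2 * a ^ (d + 1) := by gcongr
        _ = b ^ (d + 1 + 1) + (2 * (d + 1) * a ^ d * b + 2 * a ^ (d + 1)) := by ring
        _ ≤ b ^ (d + 1 + 1) + (2 * (d + 1) * a ^ d * a + 2 * a ^ (d + 1)) := by gcongr
        _ = _ := by ring

/-- The number of lattice points of sup norm `n`. -/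
theorem card_box_succ_sdiff_le (d n : ℕ) :
    (box d (n + 1) \ box d n).card ≤ 2 * d * (2 * n + 1) ^ (d - 1) := by
  rw [Finset.card_sdiff_of_subset (box_mono d n.le_succ), card_box, card_box,
    tsub_le_iff_left, show 2 * (n + 1) - 1 = 2 * n + 1 by omega]
  exact pow_le_pow_add_of_le_add_two (by omega) (by omega) d

theorem ofReal_abs_sub_le_variation (f : X.Pt → ℝ) {n : ℕ} {x y : X.Pt}
    (h : ∀ i ∈ box d n, x.1 i = y.1 i) : ENNReal.ofReal |f x - f y| ≤ variation f n :=
  le_iSup_of_le x <| le_iSup_of_le y <| le_iSup_of_le h le_rfl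

/-- The shells around `Λ_n` that the sum defining the cocycle runs over have summable variation. -/
theorem tsum_card_mul_variation_ne_top (hf : f ∈ SV X) (n : ℕ) :
    ∑' j : ℕ, ((box d (n + j + 1) \ box d (n + j)).card : ℝ≥0∞) * variation f (j + 1) ≠ ∞ := by
  have hle : ∀ j : ℕ, ((box d (n + j + 1) \ box d (n + j)).card : ℝ≥0∞) * variation f (j + 1) ≤
      ((2 * d * (2 * n + 2) ^ (d - 1) : ℕ) : ℝ≥0∞) *
        (((j + 1 : ℕ) : ℝ≥0∞) ^ (d - 1) * variation f (j + 1)) := by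
    intro j
    rw [← mul_assoc]
    gcongr
    have : (box d (n + j + 1) \ box d (n + j)).card ≤
        2 * d * (2 * n + 2) ^ (d - 1) * (j + 1) ^ (d - 1) := by
      refine (card_box_succ_sdiff_le d (n + j)).trans ?_
      -- The constant comes from `2(n + j) + 1 ≤ (2n + 2)(j + 1)`.
      rw [mul_assoc (2 * d), ← mul_pow]
      gcongr
      nlinarith [Nat.zero_le (n * j)]
    exact_mod_cast this
  refine ne_top_of_le_ne_top ?_ (ENNReal.tsum_le_tsum hle)
  rw [ENNReal.tsum_mul_left]
  exact ENNReal.mul_ne_top (ENNReal.natCast_ne_top _) hf.ne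

theorem summable_cocycle (hf : f ∈ SV X) {n : ℕ} {x y : X.Pt}
    (h : ∀ i, i ∉ box d n → y.1 i = x.1 i) :
    Summable fun k : Fin d → ℤ => f (X.shift k y) - f (X.shift k x) := by
  classical
  set a : (Fin d → ℤ) → ℝ≥0∞ := fun k => ENNReal.ofReal |f (X.shift k y) - f (X.shift k x)|
  -- Summing over all shells, instead of selecting the one containing `k`, lets the two sums be
  -- interchanged below.
  have ha : ∀ k, a k ≤ (if k ∈ box d n then a k else 0) +
      ∑' j : ℕ, if k ∈ box d (n + j + 1) \ box d (n + j) then variation f (j + 1) else 0 := by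
    intro k
    by_cases hk : k ∈ box d n
    · simp [hk]
    obtain ⟨j, hj⟩ : ∃ j, k ∈ box d (n + j + 1) \ box d (n + j) := by
      have hex := exists_mem_box k
      have h1 := Nat.find_spec hex
      have h2 : n < Nat.find hex := by
        by_contra hlt
        exact hk (box_mono d (not_lt.1 hlt) h1)
      refine ⟨Nat.find hex - n - 1, Finset.mem_sdiff.2 ⟨?_, Nat.find_min hex (by omega)⟩⟩
      rwa [show n + (Nat.find hex - n - 1) + 1 = Nat.find hex by omega]
    refine le_add_left (le_trans ?_ (ENNReal.le_tsum j))
    rw [if_pos hj]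
    -- For `i ∈ Λ_{j+1}`, that is `|i_l| ≤ j`, having `i + k ∈ Λ_n` would force `k ∈ Λ_{n+j}`. Hence
    -- `σ^k x` and `σ^k y` agree on `Λ_{j+1}`.
    refine ofReal_abs_sub_le_variation f fun i hi => h _ fun hik => ?_
    refine (Finset.mem_sdiff.1 hj).2 (mem_box.2 fun l => ?_)
    have h1 := mem_box.1 hi l
    have h2 := mem_box.1 hik l
    simp only [Pi.add_apply, abs_lt] at h1 h2 ⊢
    push_cast at h1 ⊢
    omega
  have hsum : ∑' k, a k ≠ ∞ := by
    refine ne_top_of_le_ne_top ?_ (ENNReal.tsum_le_tsum ha)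
    rw [ENNReal.tsum_add, ENNReal.tsum_comm]
    refine ENNReal.add_ne_top.2 ⟨?_, ?_⟩
    · rw [tsum_eq_sum (s := box d n) fun k hk => by simp [hk]]
      refine ENNReal.sum_ne_top.2 fun k hk => ?_
      simp [hk, a]
    · convert tsum_card_mul_variation_ne_top hf n using 3 with j
      rw [tsum_eq_sum (s := box d (n + j + 1) \ box d (n + j)) fun k hk => if_neg hk,
        Finset.sum_congr rfl fun k hk => if_pos hk, Finset.sum_const, nsmul_eq_mul]
  have := ENNReal.summable_toReal hsum
  simp only [a, ENNReal.toReal_ofReal (abs_nonneg _)] at this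
  exact this.of_abs

theorem tendsto_boxSum_sub (hf : f ∈ SV X) {n : ℕ} {x y : X.Pt}
    (h : ∀ i, i ∉ box d n → y.1 i = x.1 i) :
    Tendsto (fun m => boxSum f m y - boxSum f m x) atTop (𝓝 (cocycle f x y)) := by
  have := (summable_cocycle hf h).hasSum.comp (tendsto_box_atTop d)
  refine this.congr fun m => ?_
  simp [boxSum, Finset.sum_sub_distrib]

/-- The differences of `boxSum` telescope at each finite stage. -/
theorem cocycle_add (hf : f ∈ SV X) {n : ℕ} {x y z : X.Pt}
    (hy : ∀ i, i ∉ box d n → y.1 i = x.1 i) (hz : ∀ i, i ∉ box d n → z.1 i = y.1 i) :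
    cocycle f x y + cocycle f y z = cocycle f x z := by
  refine tendsto_nhds_unique ((tendsto_boxSum_sub hf hy).add (tendsto_boxSum_sub hf hz)) ?_
  refine (tendsto_boxSum_sub hf fun i hi => (hz i hi).trans (hy i hi)).congr fun m => ?_
  ring

theorem tendsto_variation (hf : f ∈ SV X) :
    Tendsto (fun n => variation f (n + 1)) atTop (𝓝 0) := by
  refine tendsto_of_tendsto_of_tendsto_of_le_of_le tendsto_const_nhds
    (ENNReal.tendsto_atTop_zero_of_tsum_ne_top (ne_of_lt hf)) (fun _ => zero_le) fun n => ?_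
  refine le_mul_of_one_le_left (zero_le) (one_le_pow₀ ?_)
  exact_mod_cast Nat.succ_le_succ n.zero_le

theorem continuous_of_mem_SV [DiscreteTopology 𝒜] (hf : f ∈ SV X) : Continuous f := by
  refine continuous_iff_continuousAt.2 fun x => Metric.tendsto_nhds.2 fun ε hε => ?_
  obtain ⟨n, hn⟩ := ((tendsto_variation hf).eventually
    (gt_mem_nhds (ENNReal.ofReal_pos.2 hε))).exists
  have hx : ∀ᶠ y : X.Pt in 𝓝 x, ∀ i ∈ box d (n + 1), y.1 i = x.1 i := by
    refine (Finset.eventually_all _).2 fun i _ => ?_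
    have hc : Continuous fun y : X.Pt => y.1 i := (continuous_apply i).comp continuous_subtype_val
    exact hc.continuousAt.eventually ((isOpen_discrete {x.1 i}).mem_nhds rfl)
  filter_upwards [hx] with y hy
  have := (ofReal_abs_sub_le_variation f hy).trans_lt hn
  exact (ENNReal.ofReal_lt_ofReal_iff hε).1 this

theorem symm_mem_localHomeos {φ : X.Pt ≃ₜ X.Pt} (hφ : φ ∈ localHomeos X) :
    φ.symm ∈ localHomeos X := by
  obtain ⟨n, hn⟩ := hφ
  refine ⟨n, fun x i hi => ?_⟩
  have := hn (φ.symm x) i hi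
  rw [φ.apply_symm_apply] at this
  exact this.symm

end Variation
/-! ### The specification as a finite weighted average -/

section Specification

variable {d : ℕ} {𝒜 : Type*} [Fintype 𝒜] [TopologicalSpace 𝒜] {X : Subshift d 𝒜} {f : X.Pt → ℝ}

theorem finite_completions (Λ : Finset (Fin d → ℤ)) (x : X.Pt) :
    {y : X.Pt | ∀ i, i ∉ Λ → y.1 i = x.1 i}.Finite := by
  refine Set.Finite.of_injOn (f := fun (y : X.Pt) (i : Λ) => y.1 i) (t := Set.univ)
    (fun _ _ => trivial) (fun y hy z hz h => ?_) Set.finite_univ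
  ext i
  by_cases hi : i ∈ Λ
  · exact congrFun h ⟨i, hi⟩
  · rw [hy i hi, hz i hi]

/-- The points of `X` that agree with `x` off `Λ`. -/
def completions (Λ : Finset (Fin d → ℤ)) (x : X.Pt) : Finset X.Pt :=
  (finite_completions Λ x).toFinset

theorem mem_completions {Λ : Finset (Fin d → ℤ)} {x y : X.Pt} :
    y ∈ completions Λ x ↔ ∀ i, i ∉ Λ → y.1 i = x.1 i := by
  simp [completions]

theorem glue_restrict {Λ : Finset (Fin d → ℤ)} {x y : X.Pt} (h : y ∈ completions Λ x) :
    glue Λ (fun i : Λ => y.1 i) x.1 = y.1 := by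
  ext i
  by_cases hi : i ∈ Λ
  · simp [glue, hi]
  · simp [glue, hi, mem_completions.1 h i hi]

/-- Restriction to `Λ` identifies the completions of `x` with the patterns `ω` whose gluing lies in
`X`; all other patterns have weight zero. -/
theorem sum_weight (f : X.Pt → ℝ) (m : ℕ) (Λ : Finset (Fin d → ℤ)) (A : Set X.Pt) (x : X.Pt) :
    ∑ ω : Λ → 𝒜, weight f m Λ A x ω =
      ∑ y ∈ completions Λ x, A.indicator (fun y => Real.exp (boxSum f m y)) y := by
  classical
  refine (Finset.sum_of_injOn (fun (y : X.Pt) (i : Λ) => y.1 i) (fun y hy z hz h => ?_)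
    (fun _ _ => Finset.mem_coe.2 (Finset.mem_univ _)) (fun ω _ hω => ?_) fun y hy => ?_).symm
  · have h' : (fun i : Λ => y.1 i) = fun i : Λ => z.1 i := h
    exact Subtype.ext (by rw [← glue_restrict hy, h', glue_restrict hz])
  · refine dif_neg fun ⟨hX, _⟩ => hω ⟨⟨_, hX⟩, ?_, ?_⟩
    · exact mem_completions.2 fun i hi => by simp [glue, hi]
    · ext i
      simp [glue]
  · have hg := glue_restrict hy
    have hX : glue Λ (fun i : Λ => y.1 i) x.1 ∈ X.carrier := by
      rw [hg]
      exact y.2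
    have hy' : (⟨_, hX⟩ : X.Pt) = y := Subtype.ext hg
    rw [weight]
    by_cases hA : y ∈ A
    · rw [dif_pos ⟨hX, by rwa [hy']⟩, Set.indicator_of_mem hA, hy']
    · rw [dif_neg, Set.indicator_of_notMem hA]
      rintro ⟨hX', hyA⟩
      exact hA (hy' ▸ hyA)

/-- The normalizing constant of the specification. -/
def partitionFn (f : X.Pt → ℝ) (Λ : Finset (Fin d → ℤ)) (x : X.Pt) : ℝ :=
  ∑ y ∈ completions Λ x, Real.exp (cocycle f x y)

theorem partitionFn_pos (f : X.Pt → ℝ) (Λ : Finset (Fin d → ℤ)) (x : X.Pt) :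
    0 < partitionFn f Λ x :=
  Finset.sum_pos (fun _ _ => Real.exp_pos _) ⟨x, mem_completions.2 fun _ _ => rfl⟩

theorem specification_box (hf : f ∈ SV X) (n : ℕ) (A : Set X.Pt) (x : X.Pt) :
    specification f (box d n) A x =
      ∑ y ∈ completions (box d n) x,
        A.indicator (fun y => Real.exp (cocycle f x y) / partitionFn f (box d n) x) y := by
  -- The common factor `e^{-f_m(x)}` makes numerator and denominator converge separately.
  have key : ∀ B : Set X.Pt, Tendsto (fun m => Real.exp (-boxSum f m x) *
      ∑ ω, weight f m (box d n) B x ω) atTop (𝓝 (∑ y ∈ completions (box d n) x,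
        B.indicator (fun y => Real.exp (cocycle f x y)) y)) := by
    intro B
    simp_rw [sum_weight, Finset.mul_sum]
    refine tendsto_finsetSum _ fun y hy => ?_
    by_cases hB : y ∈ B
    · simp only [Set.indicator_of_mem hB, ← Real.exp_add]
      refine (Real.continuous_exp.tendsto _).comp
        ((tendsto_boxSum_sub hf (mem_completions.1 hy)).congr fun m => ?_)
      ring
    · simp [Set.indicator_of_notMem hB]
  have h := (key A).div (key Set.univ) (by
    simpa [partitionFn] using (partitionFn_pos f (box d n) x).ne')
  refine Tendsto.limUnder_eq ?_
  convert h using 1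
  · ext m
    rw [Pi.div_apply, mul_div_mul_left _ _ (Real.exp_ne_zero _)]
  · congr 1
    simp only [Set.indicator_univ]
    rw [Finset.sum_div]
    refine Finset.sum_congr rfl fun y _ => ?_
    by_cases hA : y ∈ A <;> simp [hA, partitionFn]

/-- The average of `h` with respect to the specification on `Λ` with boundary condition `x`. -/
def specAverage (f : X.Pt → ℝ) (Λ : Finset (Fin d → ℤ)) (h : X.Pt → ℝ≥0∞) (x : X.Pt) : ℝ≥0∞ :=
  ∑ y ∈ completions Λ x, ENNReal.ofReal (Real.exp (cocycle f x y) / partitionFn f Λ x) * h y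

theorem specAverage_indicator (hf : f ∈ SV X) (n : ℕ) (A : Set X.Pt) (c : ℝ≥0∞) (x : X.Pt) :
    specAverage f (box d n) (A.indicator fun _ => c) x =
      c * ENNReal.ofReal (specification f (box d n) A x) := by
  have hp : ∀ y : X.Pt, 0 ≤ Real.exp (cocycle f x y) / partitionFn f (box d n) x :=
    fun y => div_nonneg (Real.exp_pos _).le (partitionFn_pos f _ x).le
  rw [specification_box hf, ENNReal.ofReal_sum_of_nonneg
    fun y _ => Set.indicator_nonneg (fun y _ => hp y) y, Finset.mul_sum]
  refine Finset.sum_congr rfl fun y _ => ?_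
  by_cases hA : y ∈ A <;> simp [hA, mul_comm]

theorem specAverage_add (f : X.Pt → ℝ) (Λ : Finset (Fin d → ℤ)) (g h : X.Pt → ℝ≥0∞) :
    specAverage f Λ (g + h) = specAverage f Λ g + specAverage f Λ h := by
  ext x
  simp [specAverage, mul_add, Finset.sum_add_distrib]

theorem specAverage_mono (f : X.Pt → ℝ) (Λ : Finset (Fin d → ℤ)) : Monotone (specAverage f Λ) :=
  fun _ _ hgh _ => Finset.sum_le_sum fun y _ => mul_le_mul_right (hgh y) _

theorem specAverage_iSup (f : X.Pt → ℝ) (Λ : Finset (Fin d → ℤ)) {h : ℕ → X.Pt → ℝ≥0∞}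
    (hh : Monotone h) (x : X.Pt) :
    specAverage f Λ (fun y => ⨆ k, h k y) x = ⨆ k, specAverage f Λ (h k) x := by
  simp only [specAverage, ENNReal.mul_iSup]
  exact ENNReal.finsetSum_iSup_of_monotone fun y _ _ hkl => mul_le_mul_right (hh hkl y) _

/-- A homeomorphism that only changes coordinates in `Λ_n` permutes the completions of a point. -/
theorem specAverage_comp (hf : f ∈ SV X) {n : ℕ} {φ : X.Pt ≃ₜ X.Pt}
    (hφ : ∀ x : X.Pt, ∀ i, i ∉ box d n → (φ x).1 i = x.1 i) (h : X.Pt → ℝ≥0∞) :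
    specAverage f (box d n) (fun y => h (φ y)) =
      specAverage f (box d n)
        (fun y => ENNReal.ofReal (Real.exp (cocycle f y (φ.symm y))) * h y) := by
  ext x
  refine Finset.sum_bij (fun y _ => φ y)
    (fun y hy => mem_completions.2 fun i hi => (hφ y i hi).trans (mem_completions.1 hy i hi))
    (fun _ _ _ _ h => φ.injective h) (fun z hz => ⟨φ.symm z, mem_completions.2 fun i hi => ?_,
      φ.apply_symm_apply z⟩) fun y hy => ?_
  · have := hφ (φ.symm z) i hi
    rw [φ.apply_symm_apply] at this
    exact this.symm.trans (mem_completions.1 hz i hi)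
  -- The normalizing constant depends only on `x`, so only the exponential factor changes under
  -- reindexing.
  · have hc : cocycle f x (φ y) + cocycle f (φ y) y = cocycle f x y :=
      cocycle_add hf (fun i hi => (hφ y i hi).trans (mem_completions.1 hy i hi))
        fun i hi => (hφ y i hi).symm
    dsimp only
    rw [φ.symm_apply_apply, ← mul_assoc, ← ENNReal.ofReal_mul
      (div_nonneg (Real.exp_pos _).le (partitionFn_pos f _ x).le), ← hc, Real.exp_add]
    congr 2
    ring

/-- The graph of `φ` as a subset of the topological Gibbs relation. -/
def graphOf (φ : X.Pt ≃ₜ X.Pt) : Set (Graph (topGibbsRel X)) := {p | p.1.2 = φ p.1.1}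

/-- The graphs may overlap, but identities of measures on the relation need only be checked on each
of them. -/
theorem exists_seq_localHomeos [DiscreteTopology 𝒜] (X : Subshift d 𝒜) :
    ∃ g : ℕ → X.Pt ≃ₜ X.Pt, (∀ n, g n ∈ localHomeos X) ∧ ⋃ n, graphOf (g n) = Set.univ := by
  obtain ⟨g, hg⟩ :=
    (countable_localHomeos X).exists_eq_range ⟨Homeomorph.refl _, 0, fun _ _ _ => rfl⟩
  refine ⟨g, fun n => hg ▸ Set.mem_range_self n, Set.eq_univ_of_forall fun p => ?_⟩
  obtain ⟨φ, hφ, hp⟩ := p.2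
  rw [hg] at hφ
  obtain ⟨n, rfl⟩ := hφ
  exact Set.mem_iUnion.2 ⟨n, hp⟩

end Specification

/-! ### DLR measures are topological Gibbs measures -/

section Gibbs

variable {d : ℕ} {𝒜 : Type*} [Fintype 𝒜] [TopologicalSpace 𝒜] [DiscreteTopology 𝒜]
  [MeasurableSpace 𝒜] [BorelSpace 𝒜] {X : Subshift d 𝒜} {f : X.Pt → ℝ}

/-- For indicators this is the DLR equation integrated, since conditional expectation preserves
integrals; linearity and monotone convergence do the rest. -/
theorem lintegral_specAverage (hf : f ∈ SV X) {μ : Measure X.Pt}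
    [IsProbabilityMeasure μ] (hμ : SatisfiesDLR f μ) {n : ℕ} (hn : 0 < n) {h : X.Pt → ℝ≥0∞}
    (hh : Measurable h) :
    AEMeasurable (specAverage f (box d n) h) μ ∧
      ∫⁻ x, specAverage f (box d n) h x ∂μ = ∫⁻ x, h x ∂μ := by
  have hne : (box d n).Nonempty := ⟨0, mem_box.2 fun l => by simpa using hn⟩
  refine Measurable.ennreal_induction
    (motive := fun h => AEMeasurable (specAverage f (box d n) h) μ ∧
      ∫⁻ x, specAverage f (box d n) h x ∂μ = ∫⁻ x, h x ∂μ)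
    (fun c A hA => ?_) (fun g h _ hg hh ihg ihh => ?_) (fun h hm hmono ih => ?_) hh
  · have hAe := hμ _ hne A hA
    -- Measurability is inherited from the conditional expectation, which is why only the
    -- almost-everywhere version is carried through the induction.
    have hm : AEMeasurable (specification f (box d n) A) μ :=
      integrable_condExp.aestronglyMeasurable.aemeasurable.congr hAe
    have hmul : specAverage f (box d n) (A.indicator fun _ => c) =
        fun x => c * ENNReal.ofReal (specification f (box d n) A x) :=
      funext (specAverage_indicator hf n A c)
    refine ⟨hmul ▸ hm.ennreal_ofReal.const_mul c, ?_⟩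
    have hint : Integrable (specification f (box d n) A) μ := integrable_condExp.congr hAe
    have hpos : 0 ≤ᵐ[μ] specification f (box d n) A := by
      refine ae_of_all _ fun x => ?_
      rw [specification_box hf]
      exact Finset.sum_nonneg fun y _ => Set.indicator_nonneg
        (fun y _ => div_nonneg (Real.exp_pos _).le (partitionFn_pos f _ x).le) y
    rw [hmul, lintegral_const_mul'' c hm.ennreal_ofReal,
      ← ofReal_integral_eq_lintegral_ofReal hint hpos, ← integral_congr_ae hAe,
      integral_condExp (coordSigma_le X _), lintegral_indicator_const hA,
      integral_indicator hA]
    simp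
  · rw [specAverage_add]
    refine ⟨ihg.1.add ihh.1, ?_⟩
    simp only [Pi.add_apply]
    rw [lintegral_add_left' ihg.1, lintegral_add_left hg, ihg.2, ihh.2]
  · have hS : specAverage f (box d n) (fun x => ⨆ k, h k x) =
        fun x => ⨆ k, specAverage f (box d n) (h k) x :=
      funext (specAverage_iSup f _ hmono)
    rw [hS]
    refine ⟨AEMeasurable.iSup fun k => (ih k).1, ?_⟩
    rw [lintegral_iSup' (fun k => (ih k).1)
        (ae_of_all _ fun x k l hkl => specAverage_mono f _ (hmono hkl) x),
      lintegral_iSup hm hmono]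
    exact iSup_congr fun k => (ih k).2

theorem measurable_boxSum (hf : f ∈ SV X) (m : ℕ) : Measurable (boxSum f m) := by
  refine Finset.measurable_fun_sum _ fun k _ => (continuous_of_mem_SV hf).measurable.comp ?_
  have : Measurable fun x : X.Pt => GibbsSubshift.shift k x.1 :=
    measurable_pi_lambda _ fun i => (measurable_pi_apply (i + k)).comp measurable_subtype_coe
  exact this.subtype_mk

/-- Measurability is proved on the relation, where the cocycle is a pointwise limit of differences
of `boxSum`. -/
theorem measurable_cocycle_graph (hf : f ∈ SV X) :
    Measurable fun p : Graph (topGibbsRel X) => cocycle f p.1.1 p.1.2 := by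
  refine measurable_of_tendsto_metrizable
    (fun m => ((measurable_boxSum hf m).comp (measurable_snd.comp measurable_subtype_coe)).sub
      ((measurable_boxSum hf m).comp (measurable_fst.comp measurable_subtype_coe)))
    (tendsto_pi_nhds.2 fun p => ?_)
  obtain ⟨φ, ⟨n, hn⟩, hp⟩ := p.2
  refine tendsto_boxSum_sub hf (n := n) fun i hi => ?_
  have := hn p.1.1 i hi
  rwa [← hp] at this

/-- The section `x ↦ (x, φ x)` of the topological Gibbs relation. -/
def graphSection {φ : X.Pt ≃ₜ X.Pt} (hφ : φ ∈ localHomeos X) (x : X.Pt) : Graph (topGibbsRel X) :=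
  ⟨(x, φ x), φ, hφ, rfl⟩

theorem measurable_graphSection {φ : X.Pt ≃ₜ X.Pt} (hφ : φ ∈ localHomeos X) :
    Measurable (graphSection hφ) :=
  (measurable_id.prodMk φ.measurable).subtype_mk

theorem measurable_density (hf : f ∈ SV X) {φ : X.Pt ≃ₜ X.Pt} (hφ : φ ∈ localHomeos X) :
    Measurable fun x => ENNReal.ofReal (Real.exp (cocycle f x (φ x))) :=
  ((measurable_cocycle_graph hf).comp (measurable_graphSection hφ)).exp.ennreal_ofReal

theorem map_eq_withDensity (hf : f ∈ SV X) {μ : Measure X.Pt}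
    [IsProbabilityMeasure μ] (hμ : SatisfiesDLR f μ) {φ : X.Pt ≃ₜ X.Pt} (hφ : φ ∈ localHomeos X) :
    μ.map φ = μ.withDensity fun x => ENNReal.ofReal (Real.exp (cocycle f x (φ.symm x))) := by
  have hm := measurable_density hf (symm_mem_localHomeos hφ)
  obtain ⟨n, hn⟩ := hφ
  -- Enlarging the box makes it nonempty, as the DLR equations require.
  have hn' : ∀ x : X.Pt, ∀ i, i ∉ box d (n + 1) → (φ x).1 i = x.1 i :=
    fun x i hi => hn x i fun h => hi (box_mono d n.le_succ h)
  ext A hA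
  have h1 : Measurable (A.indicator (1 : X.Pt → ℝ≥0∞)) := measurable_one.indicator hA
  calc μ.map φ A = ∫⁻ x, A.indicator 1 (φ x) ∂μ := by
        rw [← lintegral_map h1 φ.measurable, lintegral_indicator_one hA]
    _ = ∫⁻ x, ENNReal.ofReal (Real.exp (cocycle f x (φ.symm x))) * A.indicator 1 x ∂μ := by
        have h2 : Measurable fun x => A.indicator (1 : X.Pt → ℝ≥0∞) (φ x) := h1.comp φ.measurable
        have h3 : Measurable fun x =>
            ENNReal.ofReal (Real.exp (cocycle f x (φ.symm x))) * A.indicator (1 : X.Pt → ℝ≥0∞) x :=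
          hm.mul h1
        rw [← (lintegral_specAverage hf hμ n.succ_pos h2).2,
          ← (lintegral_specAverage hf hμ n.succ_pos h3).2]
        exact lintegral_congr fun x => congrFun (specAverage_comp hf hn' _) x
    _ = _ := by
        rw [withDensity_apply _ hA, ← lintegral_indicator hA]
        refine lintegral_congr fun x => ?_
        by_cases hx : x ∈ A <;> simp [hx]

/-- The saturation of `A` lies in the countable union of the sets `φ(A)`, each of measure
`(φ⁻¹)_*μ(A)`. -/
theorem isQuasiInvariant_topGibbsRel {μ : Measure X.Pt}
    (h : ∀ φ ∈ localHomeos X, μ.map φ ≪ μ) : IsQuasiInvariant μ (topGibbsRel X) := by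
  intro A hA hA0
  have hsub : saturation (topGibbsRel X) A ⊆ ⋃ φ ∈ localHomeos X, φ.symm ⁻¹' A := by
    rintro y ⟨x, hx, φ, hφ, rfl⟩
    exact Set.mem_biUnion hφ (by simpa using hx)
  refine measure_mono_null hsub ((measure_biUnion_null_iff (countable_localHomeos X)).2
    fun φ hφ => ?_)
  have := h _ (symm_mem_localHomeos hφ) hA0
  rwa [Measure.map_apply φ.symm.measurable hA] at this

/-! ### Counting measures on graphs of local homeomorphisms -/

theorem measurableSet_graphOf (φ : X.Pt ≃ₜ X.Pt) : MeasurableSet (graphOf φ) :=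
  measurableSet_eq_fun (measurable_snd.comp measurable_subtype_coe)
    (φ.measurable.comp (measurable_fst.comp measurable_subtype_coe))

/-- Each fibre over `x` meets the graph in exactly one point. -/
theorem leftCountingMeasure_restrict_graphOf (μ : Measure X.Pt) {φ : X.Pt ≃ₜ X.Pt}
    (hφ : φ ∈ localHomeos X) :
    (leftCountingMeasure μ (topGibbsRel X)).restrict (graphOf φ) = μ.map (graphSection hφ) := by
  ext C hC
  have hs := measurable_graphSection hφ
  rw [Measure.restrict_apply hC, leftCountingMeasure_topGibbsRel_apply X μ
    (hC.inter (measurableSet_graphOf φ)), Measure.map_apply hs hC,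
    ← lintegral_indicator_one (hs hC)]
  refine lintegral_congr fun x => ?_
  have hsub : {p : Graph (topGibbsRel X) | p.1.1 = x} ∩ (C ∩ graphOf φ) =
      C ∩ {graphSection hφ x} := by
    ext p
    constructor
    · rintro ⟨hp, hC, hg⟩
      have hp' : p.1.1 = x := hp
      have hg' : p.1.2 = φ p.1.1 := hg
      exact ⟨hC, Subtype.ext (Prod.ext hp' (by rw [hg', hp']; rfl))⟩
    · rintro ⟨hC, rfl⟩
      exact ⟨rfl, hC, rfl⟩
  rw [hsub]
  by_cases hx : graphSection hφ x ∈ C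
  · rw [Set.inter_eq_right.2 (Set.singleton_subset_iff.2 hx)]
    simp [hx]
  · rw [Set.inter_singleton_eq_empty.2 hx]
    simp [hx]

/-- The flip exchanges the graphs of `φ` and `φ⁻¹`, and the flipped point `(x, φ⁻¹ x)` is the
section of `φ` at `φ⁻¹ x`. -/
theorem rightCountingMeasure_restrict_graphOf (μ : Measure X.Pt) {φ : X.Pt ≃ₜ X.Pt}
    (hφ : φ ∈ localHomeos X) :
    (rightCountingMeasure μ (topGibbsRel X)).restrict (graphOf φ) =
      (μ.map φ.symm).map (graphSection hφ) := by
  have hflip : Measurable fun p : Graph (topGibbsRel X) =>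
      (⟨(p.1.2, p.1.1), Std.Symm.symm _ _ p.2⟩ : Graph (topGibbsRel X)) :=
    (measurable_swap.comp measurable_subtype_coe).subtype_mk
  have hpre : (fun p : Graph (topGibbsRel X) =>
      (⟨(p.1.2, p.1.1), Std.Symm.symm _ _ p.2⟩ : Graph (topGibbsRel X))) ⁻¹' graphOf φ =
        graphOf φ.symm := by
    ext p
    exact eq_comm.trans φ.toEquiv.eq_symm_apply.symm
  rw [rightCountingMeasure, Measure.restrict_map hflip (measurableSet_graphOf φ), hpre,
    leftCountingMeasure_restrict_graphOf μ (symm_mem_localHomeos hφ),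
    Measure.map_map hflip (measurable_graphSection _),
    Measure.map_map (measurable_graphSection hφ) φ.symm.measurable]
  congr 1
  ext1 x
  exact Subtype.ext (Prod.ext rfl (φ.apply_symm_apply x).symm)

/-- Each graph has finite mass. This is what allows a density to be recognized as the Radon–Nikodym
derivative. -/
theorem sigmaFinite_rightCountingMeasure (μ : Measure X.Pt) [IsProbabilityMeasure μ] :
    SigmaFinite (rightCountingMeasure μ (topGibbsRel X)) := by
  obtain ⟨g, hg, hcover⟩ := exists_seq_localHomeos X
  refine ⟨⟨⟨fun n => graphOf (g n), fun _ => trivial, fun n => ?_, hcover⟩⟩⟩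
  rw [← Measure.restrict_apply_univ, rightCountingMeasure_restrict_graphOf μ (hg n),
    Measure.map_apply (measurable_graphSection _) .univ]
  have := Measure.isProbabilityMeasure_map (μ := μ) (g n).symm.measurable.aemeasurable
  exact measure_lt_top _ _

theorem leftCountingMeasure_eq_withDensity (hf : f ∈ SV X) {μ : Measure X.Pt}
    (h : ∀ φ ∈ localHomeos X, μ.map φ =
      μ.withDensity fun x => ENNReal.ofReal (Real.exp (cocycle f x (φ.symm x)))) :
    leftCountingMeasure μ (topGibbsRel X) =
      (rightCountingMeasure μ (topGibbsRel X)).withDensity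
        fun p => ENNReal.ofReal (Real.exp (-(cocycle f p.1.1 p.1.2))) := by
  obtain ⟨g, hg, hcover⟩ := exists_seq_localHomeos X
  refine (Measure.ext_iff_of_iUnion_eq_univ hcover).2 fun n => ?_
  have hs := measurable_graphSection (hg n)
  have hc : Measurable fun p : Graph (topGibbsRel X) =>
      ENNReal.ofReal (Real.exp (-(cocycle f p.1.1 p.1.2))) :=
    (measurable_cocycle_graph hf).neg.exp.ennreal_ofReal
  rw [restrict_withDensity (measurableSet_graphOf _),
    rightCountingMeasure_restrict_graphOf μ (hg n), leftCountingMeasure_restrict_graphOf μ (hg n),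
    h _ (symm_mem_localHomeos (hg n)), Homeomorph.symm_symm]
  have hcs : Measurable fun x => ENNReal.ofReal (Real.exp
      (-(cocycle f (graphSection (hg n) x).1.1 (graphSection (hg n) x).1.2))) := hc.comp hs
  ext C hC
  rw [Measure.map_apply hs hC, withDensity_apply _ hC, setLIntegral_map hC hc hs,
    setLIntegral_withDensity_eq_setLIntegral_mul _
      (measurable_density hf (hg n)) hcs (hs hC), ← setLIntegral_one]
  -- On the graph, the density `e^{c_f}` of `(φ⁻¹)_*μ` cancels `e^{-c_f}`.
  refine setLIntegral_congr_fun (hs hC) fun x _ => ?_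
  change 1 = ENNReal.ofReal (Real.exp (cocycle f x (g n x))) *
    ENNReal.ofReal (Real.exp (-cocycle f x (g n x)))
  rw [← ENNReal.ofReal_mul (Real.exp_pos _).le, ← Real.exp_add, add_neg_cancel, Real.exp_zero,
    ENNReal.ofReal_one]

end Gibbs

end

end GibbsSubshift

theorem mainTheorem3 {d : ℕ} (hd : 0 < d) {𝒜 : Type*} [Fintype 𝒜] [TopologicalSpace 𝒜]
    [DiscreteTopology 𝒜] [MeasurableSpace 𝒜] [BorelSpace 𝒜] (X : GibbsSubshift.Subshift d 𝒜)
    (f : X.Pt → ℝ) (hf : f ∈ GibbsSubshift.SV X) (μ : Measure X.Pt) [IsProbabilityMeasure μ]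
    (hμ : GibbsSubshift.SatisfiesDLR f μ) :
    GibbsSubshift.IsTopologicalGibbs f μ ∧
      ∀ φ ∈ GibbsSubshift.localHomeos X,
        μ.map φ ≪ μ ∧
          (μ.map φ).rnDeriv μ =ᵐ[μ]
            fun x => ENNReal.ofReal (Real.exp (GibbsSubshift.cocycle f x (φ.symm x))) := by
  have hmap := fun φ hφ => GibbsSubshift.map_eq_withDensity hf hμ (φ := φ) hφ
  have hac : ∀ φ ∈ GibbsSubshift.localHomeos X, μ.map φ ≪ μ := fun φ hφ => by
    rw [hmap φ hφ]
    exact withDensity_absolutelyContinuous _ _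
  refine ⟨⟨GibbsSubshift.isQuasiInvariant_topGibbsRel hac, ?_⟩, fun φ hφ => ⟨hac φ hφ, ?_⟩⟩
  · have := GibbsSubshift.sigmaFinite_rightCountingMeasure μ
    rw [GibbsSubshift.radonNikodym, GibbsSubshift.leftCountingMeasure_eq_withDensity hf hmap]
    exact Measure.rnDeriv_withDensity _
      (GibbsSubshift.measurable_cocycle_graph hf).neg.exp.ennreal_ofReal
  · rw [hmap φ hφ]
    exact Measure.rnDeriv_withDensity _ (GibbsSubshift.measurable_density hf
      (GibbsSubshift.symm_mem_localHomeos hφ))
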